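/- For complex parameters with no $b_j\in\{0,-1,-2,\dots\}$ and $p\le q$ let $${}_pF_q(a_1,\dots,a_p;b_1,\dots,b_q;z)=\sum_{n=0}^\infty\frac{(a_1)_n\cdots(a_p)_n}{(b_1)_n\cdots(b_q)_n}\,\frac{z^n}{n!},$$ where $(x)_n=x(x+1)\cdots(x+n-1)$, and let $${}_p\tilde F_q(a_1,\dots,a_p;b_1,\dots,b_q;z)=\sum_{n=0}^\infty\frac{(a_1)_n\cdots(a_p)_n}{\Gamma(b_1+n)\cdots\Gamma(b_q+n)}\,\frac{z^n}{n!}$$ be the regularized function, so that ${}_pF_q=\Gamma(b_1)\cdots\Gamma(b_q)\,{}_p\tilde F_q$. For every odd integer $L\ge 1$ put $$c_L=\frac{\pi}{4}\,(2\cdot 1+1)\,\frac{(-1)^{L-1}\,i^{2L-2}\,2^{2-4L}\,\bigl(1+(-1)^{L+1}\bigr)^2}{2L+1}=\frac{3\pi\,2^{2-4L}}{2L+1}.$$ Then, for every $z\in\mathbb{C}$, $${}_2F_3\left(\tfrac12,\tfrac32;1,1,\tfrac52;z\right)=\sum_{L\ge 1,\ L\text{ odd}}c_L\,z^{L-1}\left(\frac{L+1}{16\,\Gamma\left(\frac{2L+5}{2}\right)}\binom{L+1}{\frac{L+1}{2}}\,z\;{}_1F_2\left(\tfrac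 L2+1;\tfrac L2+\tfrac32,L+\tfrac52;\tfrac z4\right)+\frac{L}{\Gamma\left(\frac{2L+1}{2}\right)}\binom{L-1}{\frac{L-1}{2}}\;{}_1F_2\left(\tfrac L2;\tfrac L2+\tfrac12,L+\tfrac12;\tfrac z4\right)\right)^2$$ and also $${}_2F_3\left(\tfrac12,\tfrac32;1,1,\tfrac52;z\right)=\sum_{L\ge 1,\ L\text{ odd}}c_L\,z^{L-1}\left(\frac{(L+1)\,\Gamma(L+2)}{16\,\Gamma\left(\frac L2+\frac32\right)}\,z\;{}_1\tilde F_2\left(\tfrac L2+1;L+\tfrac52,\tfrac L2+\tfrac32;\tfrac z4\right)+\frac{\Gamma(L+1)}{\Gamma\left(\frac L2+\frac12\right)}\;{}_1\tilde F_2\left(\tfrac L2;L+\tfrac12,\tfrac L2+\tfrac12;\tfrac z4\right)\right)^2,$$ both series being absolutely convergent. (Here $z^0=1$, also at $z=0$.) -/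

import Mathlib

/-- The generalized hypergeometric function `pFq(a; b; z)`, given by the power series
`∑ₙ (∏ᵢ (aᵢ)ₙ / ∏ⱼ (bⱼ)ₙ) zⁿ / n!`, where `(x)ₙ` is the rising factorial. The parameter lists
are multisets, so repeated parameters are counted with multiplicity. For `p ≤ q` and `bⱼ` not
in `{0, -1, -2, …}` the series converges absolutely for every complex `z`. -/
noncomputable def pFq (a b : Multiset ℂ) (z : ℂ) : ℂ :=
  ∑' n : ℕ, (a.map (ascPochhammer ℂ n).eval).prod / (b.map (ascPochhammer ℂ n).eval).prod
    * z ^ n / (n.factorial : ℂ)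

/-! Put t = z/4 and f(x) = x I₀(2x√t) = ∑ tᵐ/(m!)² x^(2m+1). Both sides of the identity evaluate
(3/2) ∫_{-1}^{1} f². Integrating term by term and using ∑ₖ C(n,k)² = C(2n,n) gives the ₂F₃
(`pFq_two_three_eq_tsum`). Parseval for Legendre polynomials gives ∑ (2l + 3/2) cₗ², where cₗ = ∫ f
P_(2l+1) and L = 2l+1; each cₗ is a combination of two ₁F₂
(`hasSum_besselCoeff_mul_legendreMoment`).

No integral is ever formed. Parseval for two odd monomials is a finite sum of closed-form moments
that telescopes (`hasSum_legendreMoment_mul`). It extends to f by Fubini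
(`hasSum_sq_tsum_mul_legendreMoment`), where absolute convergence is immediate because all the
moments are nonnegative. The rest matches Gamma factors. `HasSum` over ℂ is unconditional, hence
absolute, convergence. -/

/-! ### Legendre moments and Parseval's identity -/

/-- The integral `∫_{-1}^{1} x^(2m+1) P_(2l+1)(x) dx` of an odd monomial against a Legendre
polynomial, in closed form. -/
noncomputable def legendreMoment (l m : ℕ) : ℝ :=
  (m.descFactorial l : ℝ) * Real.Gamma (m + 3 / 2) / Real.Gamma (m + l + 5 / 2)

theorem legendreMoment_nonneg (l m : ℕ) : 0 ≤ legendreMoment l m := by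
  have h₁ : 0 < Real.Gamma ((m : ℝ) + 3 / 2) := Real.Gamma_pos_of_pos (by positivity)
  have h₂ : 0 < Real.Gamma ((m : ℝ) + l + 5 / 2) := Real.Gamma_pos_of_pos (by positivity)
  unfold legendreMoment
  positivity

theorem legendreMoment_eq_zero_of_lt {l m : ℕ} (h : m < l) : legendreMoment l m = 0 := by
  simp [legendreMoment, Nat.descFactorial_of_lt h]

theorem cast_descFactorial_succ_eq_sub_mul (m l : ℕ) :
    (m.descFactorial (l + 1) : ℝ) = ((m : ℝ) - l) * m.descFactorial l := by
  rcases le_or_gt l m with h | h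
  · rw [Nat.descFactorial_succ]
    push_cast [Nat.cast_sub h]
    ring
  · simp [Nat.descFactorial_of_lt h]

/-- Partial sums of the Parseval identity for odd monomials, in telescoped form. -/
theorem sum_range_legendreMoment_mul (m n N : ℕ) :
    ∑ l ∈ Finset.range N, (2 * (l : ℝ) + 3 / 2) * (legendreMoment l m * legendreMoment l n) =
      (1 - (m.descFactorial N : ℝ) * Real.Gamma (m + 3 / 2) / Real.Gamma (m + N + 3 / 2) *
        ((n.descFactorial N : ℝ) * Real.Gamma (n + 3 / 2) / Real.Gamma (n + N + 3 / 2))) /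
      ((m : ℝ) + n + 3 / 2) := by
  induction N with
  | zero =>
    have h₁ : Real.Gamma ((m : ℝ) + 3 / 2) ≠ 0 := (Real.Gamma_pos_of_pos (by positivity)).ne'
    have h₂ : Real.Gamma ((n : ℝ) + 3 / 2) ≠ 0 := (Real.Gamma_pos_of_pos (by positivity)).ne'
    simp [h₁, h₂]
  | succ N ih =>
    have h (k : ℕ) : Real.Gamma ((k : ℝ) + N + 5 / 2) =
        ((k : ℝ) + N + 3 / 2) * Real.Gamma ((k : ℝ) + N + 3 / 2) := by
      rw [← Real.Gamma_add_one (by positivity)]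
      congr 1
      ring
    have h' (k : ℕ) : (k : ℝ) + (N + 1 : ℕ) + 3 / 2 = k + N + 5 / 2 := by
      push_cast
      ring
    have hm : Real.Gamma ((m : ℝ) + N + 3 / 2) ≠ 0 := (Real.Gamma_pos_of_pos (by positivity)).ne'
    have hn : Real.Gamma ((n : ℝ) + N + 3 / 2) ≠ 0 := (Real.Gamma_pos_of_pos (by positivity)).ne'
    have hm' : (m : ℝ) + N + 3 / 2 ≠ 0 := by positivity
    have hn' : (n : ℝ) + N + 3 / 2 ≠ 0 := by positivity
    have hmn : (m : ℝ) + n + 3 / 2 ≠ 0 := by positivity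
    rw [Finset.sum_range_succ, ih, h', h', cast_descFactorial_succ_eq_sub_mul,
      cast_descFactorial_succ_eq_sub_mul, legendreMoment, legendreMoment, h, h]
    generalize Real.Gamma ((m : ℝ) + N + 3 / 2) = G at *
    generalize Real.Gamma ((n : ℝ) + N + 3 / 2) = H at *
    generalize Real.Gamma ((m : ℝ) + 3 / 2) = g at *
    generalize Real.Gamma ((n : ℝ) + 3 / 2) = k at *
    -- What remains is (m+N+3/2)(n+N+3/2) - (m-N)(n-N) = (2N+3/2)(m+n+3/2).
    field_simp
    ring

/-- Parseval's identity for odd monomials. -/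
theorem hasSum_legendreMoment_mul (m n : ℕ) :
    HasSum (fun l : ℕ ↦ (2 * (l : ℝ) + 3 / 2) * (legendreMoment l m * legendreMoment l n))
      (1 / ((m : ℝ) + n + 3 / 2)) := by
  have h := hasSum_sum_of_ne_finset_zero (L := .unconditional ℕ) (s := Finset.range (m + 1))
    (f := fun l : ℕ ↦ (2 * (l : ℝ) + 3 / 2) * (legendreMoment l m * legendreMoment l n))
    (fun l hl ↦ by
      rw [legendreMoment_eq_zero_of_lt (by simpa using hl)]
      simp)
  rw [sum_range_legendreMoment_mul] at h
  -- The remainder at N = m+1 contains the falling factorial of m of length m+1, which is 0.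
  simpa [Nat.descFactorial_of_lt (Nat.lt_succ_self m)] using h

/-- The double series obtained by expanding `∫_{-1}^{1} f²` with `f(x) = ∑ wₘ x^(2m+1)`, summed
through the Legendre coefficients of `f`. -/
theorem hasSum_sq_tsum_mul_legendreMoment {w : ℕ → ℂ} (hw : Summable fun m ↦ ‖w m‖)
    (hw' : ∀ l, Summable fun m ↦ ‖w m * legendreMoment l m‖) :
    HasSum (fun l : ℕ ↦ (2 * (l : ℂ) + 3 / 2) * (∑' m, w m * legendreMoment l m) ^ 2)
      (∑' p : ℕ × ℕ, w p.1 * w p.2 / ((p.1 : ℂ) + p.2 + 3 / 2)) := by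
  set F : (ℕ × ℕ) × ℕ → ℂ := fun q ↦ w q.1.1 * w q.1.2 *
    (((2 * (q.2 : ℝ) + 3 / 2) * (legendreMoment q.2 q.1.1 * legendreMoment q.2 q.1.2) : ℝ) : ℂ)
    with hF
  have hnorm (p : ℕ × ℕ) (l : ℕ) : ‖F (p, l)‖ = ‖w p.1‖ * ‖w p.2‖ *
      ((2 * (l : ℝ) + 3 / 2) * (legendreMoment l p.1 * legendreMoment l p.2)) := by
    have h₁ := legendreMoment_nonneg l p.1
    have h₂ := legendreMoment_nonneg l p.2
    simp only [hF]
    rw [norm_mul, norm_mul, Complex.norm_real, Real.norm_of_nonneg (by positivity)]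
  -- Since the moments are nonnegative, Parseval for monomials also sums the absolute values.
  have hrow (p : ℕ × ℕ) : HasSum (fun l ↦ ‖F (p, l)‖)
      (‖w p.1‖ * ‖w p.2‖ * (1 / ((p.1 : ℝ) + p.2 + 3 / 2))) := by
    simp only [hnorm]
    exact (hasSum_legendreMoment_mul p.1 p.2).mul_left _
  have hsum : Summable F := by
    refine Summable.of_norm ((summable_prod_of_nonneg fun q ↦ norm_nonneg _).2
      ⟨fun p ↦ (hrow p).summable, ?_⟩)
    simp only [(hrow _).tsum_eq]
    refine Summable.of_nonneg_of_le (fun p ↦ by positivity) (fun p ↦ ?_)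
      (hw.mul_of_nonneg hw (fun _ ↦ norm_nonneg _) (fun _ ↦ norm_nonneg _))
    refine mul_le_of_le_one_right (by positivity) ?_
    rw [div_le_one (by positivity)]
    have : (0 : ℝ) ≤ (p.1 : ℝ) + p.2 := by positivity
    linarith
  have hleft (p : ℕ × ℕ) : HasSum (fun l ↦ F (p, l))
      (w p.1 * w p.2 / ((p.1 : ℂ) + p.2 + 3 / 2)) := by
    have h := (Complex.hasSum_ofReal.2 (hasSum_legendreMoment_mul p.1 p.2)).mul_left (w p.1 * w p.2)
    convert! h using 1
    push_cast
    ring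
  have htot := hsum.hasSum
  rw [← (htot.prod_fiberwise hleft).tsum_eq] at htot
  -- Fubini: for fixed l, the sum over pairs factors as the square of the l-th Legendre coefficient.
  have hswap := (Equiv.prodComm ℕ (ℕ × ℕ)).hasSum_iff.2 htot
  refine hswap.prod_fiberwise fun l ↦ ?_
  have h := ((summable_mul_of_summable_norm (hw' l) (hw' l)).hasSum).mul_left
    (2 * (l : ℂ) + 3 / 2)
  rw [← tsum_mul_tsum_of_summable_norm (hw' l) (hw' l), ← sq] at h
  convert! h using 2 with p
  simp only [Function.comp, Equiv.prodComm_apply, Prod.swap, hF]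
  push_cast
  ring

/-! ### Pochhammer symbols -/

theorem ascPochhammer_eval_half (n : ℕ) :
    (ascPochhammer ℂ n).eval (1 / 2) = (Nat.centralBinom n : ℂ) * n.factorial / 4 ^ n := by
  induction n with
  | zero => simp
  | succ n ih =>
    have h : ((n : ℂ) + 1) * (Nat.centralBinom (n + 1) : ℂ) =
        2 * (2 * n + 1) * Nat.centralBinom n := by
      exact_mod_cast Nat.succ_mul_centralBinom_succ n
    rw [ascPochhammer_succ_eval, ih, Nat.factorial_succ, pow_succ]
    push_cast
    field_simp
    linear_combination (-2 * (n.factorial : ℂ)) * h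

theorem ascPochhammer_eval_mul_add (a : ℂ) (n : ℕ) :
    (ascPochhammer ℂ n).eval a * (a + n) = a * (ascPochhammer ℂ n).eval (a + 1) := by
  rw [← ascPochhammer_succ_eval, ascPochhammer_succ_left]
  simp

theorem ascPochhammer_eval_ne_zero {a : ℂ} (ha : ∀ k : ℕ, a ≠ -k) (n : ℕ) :
    (ascPochhammer ℂ n).eval a ≠ 0 := by
  rw [← Complex.Gamma_add_nat_div_Gamma_eq a ha]
  refine div_ne_zero (Complex.Gamma_ne_zero fun m h ↦ ha (n + m) ?_) (Complex.Gamma_ne_zero ha)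
  push_cast
  linear_combination h

theorem ne_neg_natCast_of_re_pos {a : ℂ} (ha : 0 < a.re) (k : ℕ) : a ≠ -k := by
  rintro rfl
  have : (0 : ℝ) ≤ k := k.cast_nonneg
  simp at ha
  linarith

/-! ### The ₂F₃ as a Cauchy square of Bessel coefficients -/

/-- The coefficients `tᵐ / (m!)²` of the modified Bessel function `I₀(2 √t)`. -/
noncomputable def besselCoeff (t : ℂ) (m : ℕ) : ℂ := t ^ m / (m.factorial : ℂ) ^ 2

theorem summable_norm_besselCoeff (t : ℂ) : Summable fun m ↦ ‖besselCoeff t m‖ := by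
  refine Summable.of_nonneg_of_le (fun _ ↦ norm_nonneg _) (fun m ↦ ?_)
    (Real.summable_pow_div_factorial ‖t‖)
  have h : (1 : ℝ) ≤ m.factorial := by exact_mod_cast m.factorial_pos
  rw [besselCoeff, norm_div, norm_pow, norm_pow, Complex.norm_natCast]
  gcongr
  nlinarith

/-- Multiplying by (n!)² turns each product 1/(i! j!)² into C(n,i)², and the squares of a row of
Pascal's triangle sum to the central binomial coefficient. -/
theorem sum_antidiagonal_besselCoeff_mul (t : ℂ) (n : ℕ) :
    ∑ p ∈ Finset.HasAntidiagonal.antidiagonal n, besselCoeff t p.1 * besselCoeff t p.2 =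
      Nat.centralBinom n * t ^ n / (n.factorial : ℂ) ^ 2 := by
  rw [Nat.centralBinom_eq_two_mul_choose, ← Nat.sum_range_choose_sq,
    ← Finset.Nat.sum_antidiagonal_eq_sum_range_succ_mk (fun p ↦ n.choose p.1 ^ 2)]
  push_cast
  rw [Finset.sum_mul, Finset.sum_div]
  refine Finset.sum_congr rfl fun p hp ↦ ?_
  obtain rfl := Finset.HasAntidiagonal.mem_antidiagonal.1 hp
  have h : ((p.1 + p.2).choose p.1 : ℂ) * p.1.factorial * p.2.factorial =
      (p.1 + p.2).factorial := by
    rw [Nat.choose_symm_add]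
    exact_mod_cast Nat.add_choose_mul_factorial_mul_factorial p.1 p.2
  have h₁ : (p.1.factorial : ℂ) ≠ 0 := by exact_mod_cast p.1.factorial_ne_zero
  have h₂ : (p.2.factorial : ℂ) ≠ 0 := by exact_mod_cast p.2.factorial_ne_zero
  have h₃ : ((p.1 + p.2).choose p.1 : ℂ) ≠ 0 := by
    exact_mod_cast (Nat.choose_pos (Nat.le_add_right _ _)).ne'
  rw [besselCoeff, besselCoeff, ← h]
  field_simp
  ring

/-- `(1/2)ₙ (3/2)ₙ / ((1)ₙ² (5/2)ₙ n!)` as the Cauchy square of `besselCoeff`, weighted by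
`1 / (n + 3/2)`. -/
theorem pFq_two_three_eq_tsum (z : ℂ) :
    pFq {1 / 2, 3 / 2} {1, 1, 5 / 2} z =
      3 / 2 * ∑' p : ℕ × ℕ, besselCoeff (z / 4) p.1 * besselCoeff (z / 4) p.2 /
        ((p.1 : ℂ) + p.2 + 3 / 2) := by
  have hs : Summable fun p : ℕ × ℕ ↦ besselCoeff (z / 4) p.1 * besselCoeff (z / 4) p.2 /
      ((p.1 : ℂ) + p.2 + 3 / 2) := by
    have hw := summable_norm_besselCoeff (z / 4)
    refine Summable.of_norm_bounded
      (hw.mul_of_nonneg hw (fun _ ↦ norm_nonneg _) (fun _ ↦ norm_nonneg _)) fun p ↦ ?_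
    rw [norm_div, norm_mul]
    refine div_le_self (by positivity) ?_
    have h : ((p.1 : ℂ) + p.2 + 3 / 2) = (((p.1 : ℝ) + p.2 + 3 / 2 : ℝ) : ℂ) := by
      push_cast
      ring
    have h' : (0 : ℝ) ≤ (p.1 : ℝ) + p.2 := by positivity
    rw [h, Complex.norm_real, Real.norm_of_nonneg (by positivity)]
    linarith
  have h := ((Finset.HasAntidiagonal.sigmaAntidiagonalEquivProd (A := ℕ)).hasSum_iff.2
    hs.hasSum).sigma (fun n ↦ hasSum_fintype _)
  rw [← h.tsum_eq, ← tsum_mul_left, pFq]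
  refine tsum_congr fun n ↦ ?_
  have hsum : (∑ x : Finset.HasAntidiagonal.antidiagonal n, besselCoeff (z / 4) x.1.1 * besselCoeff (z / 4) x.1.2 /
      ((x.1.1 : ℂ) + x.1.2 + 3 / 2)) =
      Nat.centralBinom n * (z / 4) ^ n / (n.factorial : ℂ) ^ 2 / (n + 3 / 2) := by
    rw [← sum_antidiagonal_besselCoeff_mul, Finset.sum_div, ← Finset.sum_coe_sort
      (Finset.HasAntidiagonal.antidiagonal n)]
    refine Finset.sum_congr rfl fun x _ ↦ ?_
    have hx : (x.1.1 : ℂ) + x.1.2 = n := by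
      exact_mod_cast Finset.HasAntidiagonal.mem_antidiagonal.1 x.2
    rw [hx]
  -- This yields (3/2)ₙ/(5/2)ₙ = (3/2)/(n + 3/2), the source of the prefactor 3/2.
  have h₃ := ascPochhammer_eval_mul_add (3 / 2) n
  rw [show (3 / 2 + 1 : ℂ) = 5 / 2 by norm_num] at h₃
  have h₅ : (ascPochhammer ℂ n).eval (5 / 2) ≠ 0 :=
    ascPochhammer_eval_ne_zero (ne_neg_natCast_of_re_pos (by norm_num)) n
  have h₀ : (n : ℂ) + 3 / 2 ≠ 0 := by
    have := ne_neg_natCast_of_re_pos (a := 3 / 2) (by norm_num) n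
    contrapose! this
    linear_combination this
  have hf : (n.factorial : ℂ) ≠ 0 := by exact_mod_cast n.factorial_ne_zero
  refine Eq.trans ?_ (congrArg (fun x ↦ 3 / 2 * x) hsum.symm)
  simp only [Multiset.insert_eq_cons, Multiset.map_cons, Multiset.map_singleton,
    Multiset.prod_cons, Multiset.prod_singleton, ascPochhammer_eval_half, ascPochhammer_eval_one]
  rw [show (ascPochhammer ℂ n).eval (3 / 2) =
      3 / 2 * (ascPochhammer ℂ n).eval (5 / 2) / (n + 3 / 2) by
    rw [eq_div_iff h₀]
    linear_combination h₃]
  generalize (ascPochhammer ℂ n).eval (5 / 2) = A at *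
  rw [div_pow]
  field_simp

/-! ### Half-integer Gamma values and regularized functions -/

theorem Complex.Gamma_natCast_add_half_mul (n : ℕ) :
    Complex.Gamma (n + 1 / 2) * (4 ^ n * n.factorial) =
      (2 * n).factorial * (Real.sqrt Real.pi : ℂ) := by
  induction n with
  | zero =>
    have h : Complex.Gamma (1 / 2) = (Real.sqrt Real.pi : ℂ) := by
      rw [← Real.Gamma_one_half_eq, ← Complex.Gamma_ofReal]
      norm_num
    simpa using h
  | succ n ih =>
    have h : ((n : ℂ) + 1 / 2) ≠ 0 := by
      have := ne_neg_natCast_of_re_pos (a := 1 / 2) (by norm_num) n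
      contrapose! this
      linear_combination this
    rw [show ((n + 1 : ℕ) : ℂ) + 1 / 2 = n + 1 / 2 + 1 by push_cast; ring,
      Complex.Gamma_add_one _ h, show 2 * (n + 1) = 2 * n + 1 + 1 by ring, Nat.factorial_succ,
      Nat.factorial_succ, Nat.factorial_succ, pow_succ]
    push_cast
    linear_combination (4 * (n + 1) * (n + 1 / 2) : ℂ) * ih

/-- Termwise Γ(c+n) = (c)ₙ Γ(c), with Γ(c) finite and nonzero away from the poles. -/
theorem pFq_eq_prod_Gamma_mul_regularizedHGFun {a b : Multiset ℂ}
    (hb : ∀ c ∈ b, ∀ k : ℕ, c ≠ -k) (z : ℂ) :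
    pFq a b z = (b.map Complex.Gamma).prod * Complex.regularizedHGFun a b z := by
  rw [Complex.regularizedHGFun, Complex.regularizedHGFunSeries,
    ← FormalMultilinearSeries.ofScalarsSum, FormalMultilinearSeries.ofScalars_sum_eq,
    ← tsum_mul_left, pFq]
  refine tsum_congr fun n ↦ ?_
  have h : (b.map fun c ↦ Complex.Gamma (c + n)).prod =
      (b.map (ascPochhammer ℂ n).eval).prod * (b.map Complex.Gamma).prod := by
    rw [← Multiset.prod_map_mul]
    refine congrArg Multiset.prod (Multiset.map_congr rfl fun c hc ↦ ?_)
    rw [← Complex.Gamma_add_nat_div_Gamma_eq c (hb c hc),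
      div_mul_cancel₀ _ (Complex.Gamma_ne_zero (hb c hc))]
  have h' : (b.map Complex.Gamma).prod ≠ 0 := by
    refine Multiset.prod_ne_zero fun h0 ↦ ?_
    obtain ⟨c, hc, hc'⟩ := Multiset.mem_map.1 h0
    exact Complex.Gamma_ne_zero (hb c hc) hc'
  rw [Complex.regularizedHGFunCoeff, h, smul_eq_mul]
  generalize (b.map Complex.Gamma).prod = G at *
  field_simp

theorem hasSum_regularizedHGFun {a b : Multiset ℂ} (h : a.card ≤ b.card) (z : ℂ) :
    HasSum (fun n ↦ Complex.regularizedHGFunCoeff a b n * z ^ n)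
      (Complex.regularizedHGFun a b z) := by
  have hr := Complex.radius_regularizedHGFunSeries_eq_top h
  have hs := (Complex.regularizedHGFunSeries a b).hasSum (x := z) (by simp [hr])
  convert! hs using 2 with n
  simp [Complex.regularizedHGFunSeries, mul_comm]

theorem natCast_add_ne_zero_of_re_pos (n : ℕ) {a : ℂ} (ha : 0 < a.re) : (n : ℂ) + a ≠ 0 := by
  have := ne_neg_natCast_of_re_pos ha n
  contrapose! this
  linear_combination this

/-! ### Legendre coefficients of x I₀(2x√t) -/

/-- The normalised coefficients of the Legendre coefficient of order `2l + 1` of `x I₀(2 x √t)`. -/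
noncomputable def legendreBesselCoeff (l k : ℕ) : ℂ :=
  Complex.Gamma (k + l + 1 / 2) /
    ((k + l).factorial * k.factorial * Complex.Gamma (k + 2 * l + 5 / 2))

/-- The factor 2l + 3/2 + k lowers Γ(k+2l+5/2) to Γ(k+2l+3/2), which is the lower parameter of the
first ₁F₂. -/
theorem regularizedHGFunCoeff_half_integer (l k : ℕ) :
    Complex.Gamma (l + 1 / 2) *
        Complex.regularizedHGFunCoeff {(l : ℂ) + 1 / 2} {2 * (l : ℂ) + 3 / 2, (l : ℂ) + 1} k =
      (2 * l + 3 / 2 + k) * legendreBesselCoeff l k := by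
  have hl : 0 < ((l : ℂ) + 1 / 2).re := by simp; positivity
  have hG := Complex.Gamma_ne_zero_of_re_pos hl
  have h₀ : (2 * (l : ℂ) + 3 / 2 + k) ≠ 0 := by
    have := natCast_add_ne_zero_of_re_pos (2 * l + k) (a := 3 / 2) (by norm_num)
    push_cast at this
    contrapose! this
    linear_combination this
  simp only [Complex.regularizedHGFunCoeff, Multiset.insert_eq_cons, Multiset.map_cons,
    Multiset.map_singleton, Multiset.prod_cons, Multiset.prod_singleton]
  rw [← Complex.Gamma_add_nat_div_Gamma_eq _ (ne_neg_natCast_of_re_pos hl), legendreBesselCoeff,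
    show (k : ℂ) + 2 * l + 5 / 2 = 2 * l + 3 / 2 + k + 1 by ring, Complex.Gamma_add_one _ h₀,
    show (l : ℂ) + 1 + k = (k + l : ℕ) + 1 by push_cast; ring, Complex.Gamma_nat_eq_factorial,
    show (l : ℂ) + 1 / 2 + k = k + l + 1 / 2 by ring]
  generalize Complex.Gamma ((l : ℂ) + 1 / 2) = G at *
  generalize Complex.Gamma ((k : ℂ) + l + 1 / 2) = G' at *
  generalize Complex.Gamma (2 * (l : ℂ) + 3 / 2 + k) = H at *
  generalize 2 * (l : ℂ) + 3 / 2 + k = x at *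
  field_simp

/-- The factor k+1 reduces (k+1)! to k!, so the second ₁F₂ appears with its index shifted by one. -/
theorem regularizedHGFunCoeff_half_integer_succ (l k : ℕ) :
    Complex.Gamma (l + 3 / 2) *
        Complex.regularizedHGFunCoeff {(l : ℂ) + 3 / 2} {2 * (l : ℂ) + 7 / 2, (l : ℂ) + 2} k =
      (k + 1 : ℕ) * legendreBesselCoeff l (k + 1) := by
  have hl : 0 < ((l : ℂ) + 3 / 2).re := by simp; positivity
  have hG := Complex.Gamma_ne_zero_of_re_pos hl
  simp only [Complex.regularizedHGFunCoeff, Multiset.insert_eq_cons, Multiset.map_cons,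
    Multiset.map_singleton, Multiset.prod_cons, Multiset.prod_singleton]
  rw [← Complex.Gamma_add_nat_div_Gamma_eq _ (ne_neg_natCast_of_re_pos hl), legendreBesselCoeff,
    show ((k + 1 : ℕ) : ℂ) + 2 * l + 5 / 2 = 2 * l + 7 / 2 + k by push_cast; ring,
    show (l : ℂ) + 2 + k = (k + 1 + l : ℕ) + 1 by push_cast; ring, Complex.Gamma_nat_eq_factorial,
    show ((k + 1 : ℕ) : ℂ) + l + 1 / 2 = l + 3 / 2 + k by push_cast; ring, Nat.factorial_succ k]
  have hk : ((k + 1 : ℕ) : ℂ) ≠ 0 := Nat.cast_ne_zero.2 k.succ_ne_zero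
  push_cast at hk ⊢
  generalize Complex.Gamma ((l : ℂ) + 3 / 2) = G at *
  generalize Complex.Gamma ((l : ℂ) + 3 / 2 + k) = G' at *
  generalize Complex.Gamma (2 * (l : ℂ) + 7 / 2 + k) = H at *
  field_simp

/-- Moments with m < l vanish, so only m = k+l matters; Γ(k+l+3/2) releases the linear factor
k+l+1/2. -/
theorem besselCoeff_mul_legendreMoment (t : ℂ) (l k : ℕ) :
    besselCoeff t (k + l) * legendreMoment l (k + l) =
      t ^ l * ((k + l + 1 / 2) * legendreBesselCoeff l k * t ^ k) := by
  have h₀ : ((k : ℂ) + l + 1 / 2) ≠ 0 := by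
    have := natCast_add_ne_zero_of_re_pos (k + l) (a := 1 / 2) (by norm_num)
    exact_mod_cast this
  have hd : ((k + l).descFactorial l : ℂ) * k.factorial = (k + l).factorial := by
    have := Nat.factorial_mul_descFactorial (Nat.le_add_left l k)
    rw [Nat.add_sub_cancel] at this
    rw [mul_comm]
    exact_mod_cast this
  have hf : ((k + l).factorial : ℂ) ≠ 0 := by exact_mod_cast (k + l).factorial_ne_zero
  have hk : (k.factorial : ℂ) ≠ 0 := by exact_mod_cast k.factorial_ne_zero
  have h₁ : ((k + l).descFactorial l : ℂ) = (k + l).factorial / k.factorial := by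
    rw [← hd]
    field_simp
  rw [besselCoeff, legendreMoment, legendreBesselCoeff]
  push_cast [← Complex.Gamma_ofReal]
  rw [show (k : ℂ) + l + 3 / 2 = k + l + 1 / 2 + 1 by ring, Complex.Gamma_add_one _ h₀,
    show (k : ℂ) + l + l + 5 / 2 = k + 2 * l + 5 / 2 by ring, h₁, pow_add]
  field_simp

/-- The Legendre coefficient of order `2l + 1` of `x I₀(2 x √t)` in terms of two regularized
hypergeometric functions `₁F₂`. -/
theorem hasSum_besselCoeff_mul_legendreMoment (t : ℂ) (l : ℕ) :
    HasSum (fun m ↦ besselCoeff t m * legendreMoment l m)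
      (t ^ l * (((2 * l + 2) * Complex.Gamma (l + 3 / 2) * t *
          Complex.regularizedHGFun {(l : ℂ) + 3 / 2} {2 * (l : ℂ) + 7 / 2, (l : ℂ) + 2} t +
        (2 * l + 1) * Complex.Gamma (l + 1 / 2) *
          Complex.regularizedHGFun {(l : ℂ) + 1 / 2} {2 * (l : ℂ) + 3 / 2, (l : ℂ) + 1} t) /
        (4 * l + 3))) := by
  have h₁ := (hasSum_regularizedHGFun (a := {(l : ℂ) + 3 / 2})
    (b := {2 * (l : ℂ) + 7 / 2, (l : ℂ) + 2}) (by simp) t).mul_left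
      (Complex.Gamma (l + 3 / 2) * t)
  have h₂ := (hasSum_regularizedHGFun (a := {(l : ℂ) + 1 / 2})
    (b := {2 * (l : ℂ) + 3 / 2, (l : ℂ) + 1}) (by simp) t).mul_left (Complex.Gamma (l + 1 / 2))
  have h₁' : HasSum (fun k : ℕ ↦ (k : ℂ) * legendreBesselCoeff l k * t ^ k)
      (Complex.Gamma (l + 3 / 2) * t *
        Complex.regularizedHGFun {(l : ℂ) + 3 / 2} {2 * (l : ℂ) + 7 / 2, (l : ℂ) + 2} t) := by
    -- The k = 0 term is 0, which permits the shift.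
    rw [← hasSum_nat_add_iff' 1]
    simp only [Finset.range_one, Finset.sum_singleton, Nat.cast_zero, zero_mul, sub_zero]
    convert! h₁ using 2 with k
    linear_combination (-t * t ^ k) * regularizedHGFunCoeff_half_integer_succ l k
  have h₀ : (4 * (l : ℂ) + 3) ≠ 0 := by
    have := natCast_add_ne_zero_of_re_pos (4 * l) (a := 3) (by norm_num)
    exact_mod_cast this
  rw [← hasSum_nat_add_iff' l, Finset.sum_eq_zero (fun m hm ↦ by
    rw [legendreMoment_eq_zero_of_lt (Finset.mem_range.1 hm)]; simp), sub_zero]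
  simp only [besselCoeff_mul_legendreMoment]
  refine HasSum.mul_left _ ?_
  -- The two ₁F₂ come from (4l+3)(k+l+1/2) = (2l+2)k + (2l+1)(2l+3/2+k).
  have h := (((h₁'.mul_left (2 * l + 2 : ℂ)).add (h₂.mul_left (2 * l + 1 : ℂ))).div_const
    (4 * (l : ℂ) + 3))
  convert! h using 2 with k
  · rw [eq_div_iff h₀]
    linear_combination (-(2 * l + 1) * t ^ k : ℂ) * regularizedHGFunCoeff_half_integer l k
  · ring

/-! ### Matching the two stated forms -/

/-- Regularizing contributes Γ(n+1)Γ(b), and C(2n,n) = Γ(2n+1)/Γ(n+1)². This links the binomial form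
of the series to the regularized one. -/
theorem choose_div_Gamma_mul_pFq (n : ℕ) (a : ℂ) {b : ℂ} (hb : 0 < b.re) (w : ℂ) :
    ((2 * n).choose n : ℂ) / Complex.Gamma b * pFq {a} {(n : ℂ) + 1, b} w =
      Complex.Gamma (2 * n + 1) / Complex.Gamma (n + 1) *
        Complex.regularizedHGFun {a} {b, (n : ℂ) + 1} w := by
  have hG := Complex.Gamma_ne_zero_of_re_pos hb
  have hn : 0 < ((n : ℂ) + 1).re := by simp; positivity
  rw [pFq_eq_prod_Gamma_mul_regularizedHGFun (by
    simpa using ⟨ne_neg_natCast_of_re_pos hn, ne_neg_natCast_of_re_pos hb⟩),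
    Multiset.pair_comm b]
  have hc : ((2 * n).choose n : ℂ) * n.factorial * n.factorial = (2 * n).factorial := by
    rw [two_mul]
    exact_mod_cast Nat.add_choose_mul_factorial_mul_factorial n n
  have hf : (n.factorial : ℂ) ≠ 0 := by exact_mod_cast n.factorial_ne_zero
  have h₂ : Complex.Gamma (2 * n + 1) = (2 * n).factorial := by
    rw [← Complex.Gamma_nat_eq_factorial]
    push_cast
    rfl
  simp only [Multiset.insert_eq_cons, Multiset.map_cons, Multiset.map_singleton,
    Multiset.prod_cons, Multiset.prod_singleton]
  rw [h₂, Complex.Gamma_nat_eq_factorial, ← hc]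
  field_simp

/-- The bijection `l ↦ 2l + 1` between the natural numbers and the odd ones. -/
def natEquivOdd : ℕ ≃ {L : ℕ // Odd L} where
  toFun l := ⟨2 * l + 1, odd_two_mul_add_one l⟩
  invFun L := (L : ℕ) / 2
  left_inv l := by simp only; omega
  right_inv L := by
    obtain ⟨L, k, rfl⟩ := L
    exact Subtype.ext (by simp only; omega)

theorem parseval_prefactor (l : ℕ) :
    (1 / 4 : ℂ) * (Real.pi : ℂ) * (2 * 1 + 1) *
      ((-1 : ℂ) ^ (2 * l + 1 - 1) * Complex.I ^ (2 * (2 * l + 1) - 2) *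
        (2 : ℂ) ^ (2 - 4 * ((2 * l + 1 : ℕ) : ℤ)) * (1 + (-1 : ℂ) ^ (2 * l + 1 + 1)) ^ 2 /
          (2 * ((2 * l + 1 : ℕ) : ℂ) + 1)) =
      3 / 4 * (Real.pi : ℂ) / (((4 : ℂ) ^ l) ^ 4 * (4 * l + 3)) := by
  have h₁ : (-1 : ℂ) ^ (2 * l + 1 - 1) = 1 := by simp
  have h₂ : Complex.I ^ (2 * (2 * l + 1) - 2) = 1 := by
    rw [show 2 * (2 * l + 1) - 2 = 4 * l by omega, pow_mul, Complex.I_pow_four, one_pow]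
  have h₃ : (-1 : ℂ) ^ (2 * l + 1 + 1) = 1 := by
    rw [show 2 * l + 1 + 1 = 2 * (l + 1) by ring, pow_mul]
    simp
  have h₄ : (2 : ℂ) ^ (2 - 4 * ((2 * l + 1 : ℕ) : ℤ)) = (4 * ((4 : ℂ) ^ l) ^ 4)⁻¹ := by
    rw [show (4 : ℂ) = 2 ^ 2 by norm_num, ← pow_mul, ← pow_mul, ← pow_add, ← zpow_natCast,
      ← zpow_neg]
    congr 1
    push_cast
    ring
  have h₅ : 2 * ((2 * l + 1 : ℕ) : ℂ) + 1 = 4 * l + 3 := by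
    push_cast
    ring
  have h₀ : (4 * (l : ℂ) + 3) ≠ 0 := by
    have := natCast_add_ne_zero_of_re_pos (4 * l) (a := 3) (by norm_num)
    exact_mod_cast this
  rw [h₁, h₂, h₃, h₄, h₅]
  field_simp
  norm_num

/-- Legendre duplication at integers; it trades the stated Gamma quotients for Γ(n+1/2), at the cost
of √π and 4ⁿ. -/
theorem Gamma_two_mul_add_one_div_mul_sqrt_pi (n : ℕ) :
    Complex.Gamma (2 * n + 1) / Complex.Gamma (n + 1) * (Real.sqrt Real.pi : ℂ) =
      4 ^ n * Complex.Gamma (n + 1 / 2) := by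
  have h := Complex.Gamma_natCast_add_half_mul n
  have hf : (n.factorial : ℂ) ≠ 0 := by exact_mod_cast n.factorial_ne_zero
  rw [Complex.Gamma_nat_eq_factorial, show (2 * (n : ℂ) + 1) = (2 * n : ℕ) + 1 by push_cast; rfl,
    Complex.Gamma_nat_eq_factorial, div_mul_eq_mul_div, div_eq_iff hf]
  linear_combination -h

/-- The series in the normal form `l ↦ 2l + 1`, with regularized hypergeometric functions. -/
theorem hasSum_regularizedHGFun_sq (z : ℂ) :
    HasSum (fun l : ℕ ↦ 3 / 4 * (Real.pi : ℂ) / (((4 : ℂ) ^ l) ^ 4 * (4 * l + 3)) * z ^ (2 * l) *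
      ((2 * l + 2) / 16 * z * (Complex.Gamma (2 * (l + 1 : ℕ) + 1) /
          Complex.Gamma ((l + 1 : ℕ) + 1) *
          Complex.regularizedHGFun {(l : ℂ) + 3 / 2}
            {2 * (l : ℂ) + 7 / 2, ((l + 1 : ℕ) : ℂ) + 1} (z / 4)) +
        (2 * l + 1) * (Complex.Gamma (2 * l + 1) / Complex.Gamma (l + 1) *
          Complex.regularizedHGFun {(l : ℂ) + 1 / 2} {2 * (l : ℂ) + 3 / 2, (l : ℂ) + 1} (z / 4))) ^ 2)
      (pFq {1 / 2, 3 / 2} {1, 1, 5 / 2} z) := by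
  have hS := hasSum_besselCoeff_mul_legendreMoment (z / 4)
  have h := (hasSum_sq_tsum_mul_legendreMoment (summable_norm_besselCoeff (z / 4))
    fun l ↦ (hS l).summable.norm).mul_left (3 / 2)
  rw [← pFq_two_three_eq_tsum] at h
  convert! h using 2 with l
  rw [(hS l).tsum_eq]
  have h₁ := Gamma_two_mul_add_one_div_mul_sqrt_pi l
  have h₂ := Gamma_two_mul_add_one_div_mul_sqrt_pi (l + 1)
  rw [show ((l + 1 : ℕ) : ℂ) + 1 / 2 = l + 3 / 2 by push_cast; ring, pow_succ] at h₂
  rw [show ((l + 1 : ℕ) : ℂ) + 1 = l + 2 by push_cast; ring] at h₂ ⊢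
  have hpi : (Real.pi : ℂ) = (Real.sqrt Real.pi : ℂ) ^ 2 := by
    rw [← Complex.ofReal_pow, Real.sq_sqrt Real.pi_pos.le]
  have h₀ : (4 * (l : ℂ) + 3) ≠ 0 := by
    have := natCast_add_ne_zero_of_re_pos (4 * l) (a := 3) (by norm_num)
    exact_mod_cast this
  have h4 : (4 : ℂ) ^ l ≠ 0 := pow_ne_zero _ (by norm_num)
  generalize Complex.regularizedHGFun {(l : ℂ) + 3 / 2} _ _ = R at *
  generalize Complex.regularizedHGFun {(l : ℂ) + 1 / 2} _ _ = R' at *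
  generalize Complex.Gamma (2 * (l : ℂ) + 1) / Complex.Gamma (l + 1) = A at *
  generalize Complex.Gamma (2 * ((l + 1 : ℕ) : ℂ) + 1) / Complex.Gamma (l + 2) = B at *
  -- Duplication at l+1 gives 4^(l+1), and 4^(l+1)/16 = 4^l/4 explains the 16.
  have hB : (((2 * l + 2) / 16 * z * (B * R) + (2 * l + 1) * (A * R')) *
      (Real.sqrt Real.pi : ℂ)) = 4 ^ l * ((2 * l + 2) * Complex.Gamma (l + 3 / 2) * (z / 4) * R +
        (2 * l + 1) * Complex.Gamma (l + 1 / 2) * R') := by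
    linear_combination ((2 * l + 2) / 16 * z * R) * h₂ + ((2 * l + 1) * R') * h₁
  -- The π of the prefactor is (√π)², absorbed into the square. Of the four factors 4^l, two come
  -- from (z/4)^(2l) and two from duplication.
  calc _ = 3 / 4 / (((4 : ℂ) ^ l) ^ 4 * (4 * l + 3)) * z ^ (2 * l) *
        (((2 * l + 2) / 16 * z * (B * R) + (2 * l + 1) * (A * R')) *
          (Real.sqrt Real.pi : ℂ)) ^ 2 := by
        rw [hpi]
        ring
    _ = _ := by
        rw [hB, div_pow, mul_comm 2 l, pow_mul]
        generalize (2 * (l : ℂ) + 2) * Complex.Gamma (l + 3 / 2) * (z / 4) * R +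
          (2 * l + 1) * Complex.Gamma (l + 1 / 2) * R' = Q
        field_simp
        ring

theorem mainTheorem4 (z : ℂ) :
    HasSum
      (fun L : {L : ℕ // Odd L} =>
        (1 / 4 : ℂ) * (Real.pi : ℂ) * (2 * 1 + 1) *
          ((-1 : ℂ) ^ ((L : ℕ) - 1) * Complex.I ^ (2 * (L : ℕ) - 2) *
              (2 : ℂ) ^ (2 - 4 * ((L : ℕ) : ℤ)) * (1 + (-1 : ℂ) ^ ((L : ℕ) + 1)) ^ 2 /
            (2 * ((L : ℕ) : ℂ) + 1)) *
          z ^ ((L : ℕ) - 1) *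
          ((((L : ℕ) : ℂ) + 1) / (16 * Complex.Gamma ((2 * ((L : ℕ) : ℂ) + 5) / 2)) *
              (Nat.choose ((L : ℕ) + 1) (((L : ℕ) + 1) / 2) : ℂ) * z *
              pFq {((L : ℕ) : ℂ) / 2 + 1}
                {((L : ℕ) : ℂ) / 2 + 3 / 2, ((L : ℕ) : ℂ) + 5 / 2} (z / 4) +
            ((L : ℕ) : ℂ) / Complex.Gamma ((2 * ((L : ℕ) : ℂ) + 1) / 2) *
              (Nat.choose ((L : ℕ) - 1) (((L : ℕ) - 1) / 2) : ℂ) *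
              pFq {((L : ℕ) : ℂ) / 2}
                {((L : ℕ) : ℂ) / 2 + 1 / 2, ((L : ℕ) : ℂ) + 1 / 2} (z / 4)) ^ 2)
      (pFq {1 / 2, 3 / 2} {1, 1, 5 / 2} z) ∧
    HasSum
      (fun L : {L : ℕ // Odd L} =>
        (1 / 4 : ℂ) * (Real.pi : ℂ) * (2 * 1 + 1) *
          ((-1 : ℂ) ^ ((L : ℕ) - 1) * Complex.I ^ (2 * (L : ℕ) - 2) *
              (2 : ℂ) ^ (2 - 4 * ((L : ℕ) : ℤ)) * (1 + (-1 : ℂ) ^ ((L : ℕ) + 1)) ^ 2 /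
            (2 * ((L : ℕ) : ℂ) + 1)) *
          z ^ ((L : ℕ) - 1) *
          ((((L : ℕ) : ℂ) + 1) * Complex.Gamma (((L : ℕ) : ℂ) + 2) /
                (16 * Complex.Gamma (((L : ℕ) : ℂ) / 2 + 3 / 2)) * z *
              Complex.regularizedHGFun {((L : ℕ) : ℂ) / 2 + 1}
                {((L : ℕ) : ℂ) + 5 / 2, ((L : ℕ) : ℂ) / 2 + 3 / 2} (z / 4) +
            Complex.Gamma (((L : ℕ) : ℂ) + 1) / Complex.Gamma (((L : ℕ) : ℂ) / 2 + 1 / 2) *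
              Complex.regularizedHGFun {((L : ℕ) : ℂ) / 2}
                {((L : ℕ) : ℂ) + 1 / 2, ((L : ℕ) : ℂ) / 2 + 1 / 2} (z / 4)) ^ 2)
      (pFq {1 / 2, 3 / 2} {1, 1, 5 / 2} z) := by
  have key := hasSum_regularizedHGFun_sq z
  constructor
  · rw [← natEquivOdd.hasSum_iff]
    convert! key using 2 with l
    simp only [Function.comp, natEquivOdd, Equiv.coe_fn_mk]
    rw [parseval_prefactor, Nat.add_sub_cancel, show (2 * l + 1 + 1) / 2 = l + 1 by omega,
      show 2 * l / 2 = l by omega, show 2 * l + 1 + 1 = 2 * (l + 1) by ring,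
      ← choose_div_Gamma_mul_pFq (l + 1) _ (by simp; positivity),
      ← choose_div_Gamma_mul_pFq l _ (by simp; positivity),
      show ((2 * l + 1 : ℕ) : ℂ) / 2 + 1 = l + 3 / 2 by push_cast; ring,
      show ((2 * l + 1 : ℕ) : ℂ) / 2 + 3 / 2 = (l + 1 : ℕ) + 1 by push_cast; ring,
      show ((2 * l + 1 : ℕ) : ℂ) + 5 / 2 = 2 * l + 7 / 2 by push_cast; ring,
      show (2 * ((2 * l + 1 : ℕ) : ℂ) + 5) / 2 = 2 * l + 7 / 2 by push_cast; ring,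
      show (2 * ((2 * l + 1 : ℕ) : ℂ) + 1) / 2 = 2 * l + 3 / 2 by push_cast; ring,
      show ((2 * l + 1 : ℕ) : ℂ) / 2 + 1 / 2 = l + 1 by push_cast; ring,
      show ((2 * l + 1 : ℕ) : ℂ) + 1 / 2 = 2 * l + 3 / 2 by push_cast; ring,
      show ((2 * l + 1 : ℕ) : ℂ) / 2 = l + 1 / 2 by push_cast; ring,
      show ((2 * l + 1 : ℕ) : ℂ) = 2 * l + 1 by push_cast; ring]
    congr 2
    ring
  · rw [← natEquivOdd.hasSum_iff]
    convert! key using 2 with l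
    simp only [Function.comp, natEquivOdd, Equiv.coe_fn_mk]
    rw [parseval_prefactor, Nat.add_sub_cancel,
      show ((2 * l + 1 : ℕ) : ℂ) / 2 + 1 = l + 3 / 2 by push_cast; ring,
      show ((2 * l + 1 : ℕ) : ℂ) / 2 + 3 / 2 = (l + 1 : ℕ) + 1 by push_cast; ring,
      show ((2 * l + 1 : ℕ) : ℂ) + 5 / 2 = 2 * l + 7 / 2 by push_cast; ring,
      show ((2 * l + 1 : ℕ) : ℂ) / 2 + 1 / 2 = l + 1 by push_cast; ring,
      show ((2 * l + 1 : ℕ) : ℂ) + 1 / 2 = 2 * l + 3 / 2 by push_cast; ring,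
      show ((2 * l + 1 : ℕ) : ℂ) / 2 = l + 1 / 2 by push_cast; ring,
      show ((2 * l + 1 : ℕ) : ℂ) + 2 = 2 * (l + 1 : ℕ) + 1 by push_cast; ring,
      -- Γ(L+1) = L Γ(L) supplies the factor 2l+1 of the normal form.
      Complex.Gamma_add_one ((2 * l + 1 : ℕ) : ℂ) (Nat.cast_ne_zero.2 (by omega)),
      show ((2 * l + 1 : ℕ) : ℂ) = 2 * l + 1 by push_cast; ring]
    congr 2
    ring
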